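/- All graphs are finite and simple. Let $\mathfrak I$ be the family of \emph{contractible graphs}, i.e. the smallest family of graphs (up to isomorphism) that contains the one-vertex graph $K(1)$ and is closed under: deleting a vertex $v$ with $N_G(v)\in\mathfrak I$; gluing a new vertex $v$ whose neighbourhood is an induced subgraph $N_G(v)\in\mathfrak I$; deleting an edge $\{v_1,v_2\}$ with $N_G(v_1)\cap N_G(v_2)\in\mathfrak I$; gluing an edge between two distinct non-adjacent vertices $v_1,v_2$ with $N_G(v_1)\cap N_G(v_2)\in\mathfrak I$ (neighbourhoods are identified with the subgraphs they induce). A vertex $v$ of $G$ is \emph{contractible} if $N_G(v)\in\mathfrak I$. A (possibly empty) sequence $S=(v_1,\dots,v_k)$ is a \emph{sequence of contractible vertices} of $G$ if each $v_l$ is a contractible vertex of $G-v_1-\cdots-v_{l-1}$; then $I(G;S)=G-v_1-\cdots-v_k$. For an abelian group $A$, let $H_p(G)=H_p(G;A)$ be the simplicial homology of the clique complex of $G$, computed with oriented chains. For a contractible vertex $v$, let $I_*(v):H_p(G)\to H_p(G-v)$ be the homomorphism induced by $a-\partial(v*b)\mapsto a$, where $a$ is a $p$-cycle of $G-v$ and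 $b$ a $p$-chain of $N_G(v)$, and put $I_*(S)=I_*(v_k)\circ\cdots\circ I_*(v_1)$. Let $N$ be a finite point cloud in a metric space, let $\varepsilon_0<\varepsilon_1<\dots<\varepsilon_m$ be all the values $d(x,y)$ with $x,y\in N$, let $\mathrm{VR}_i$ be the Vietoris--Rips complex with vertex set $N$ whose simplices are the nonempty $\sigma\subseteq N$ with all pairwise distances at most $\varepsilon_i$, and let $G_i$ be the $1$-skeleton of $\mathrm{VR}_i$. For every $0\le i\le m$ let $S_i$ be a sequence of contractible vertices of $G_i$. Then, for every abelian group $A$ of coefficients and every $p\ge 0$, the maps $I_*(S_i)$ exist and are isomorphisms $H_p(G_i)\cong H_p(I(G_i;S_i))$, and for all $0\le i\le j\le m$ there is a homomorphism \[\iota_*:H_p(I(G_i;S_i))\to H_p(I(G_j;S_j))\] with $\iota_*\circ I_*(S_i)=I_*(S_j)\circ (G_i\hookrightarrow G_j)_*$, such that the persistent homology group $H_p^{i,j}=\mathrm{Im}\bigl(H_p(\mathrm{VR}_i)\to H_p(\mathrm{VR}_j)\bigr)$ is isomorphic to $\mathrm{Im}(\iota_*)$. -/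

import Mathlib

namespace ContractibleGraph

universe u w

/-- The family of contractible graphs, generated from the one-vertex graph by the contractible
transformations: deleting or gluing a vertex whose neighbourhood is contractible, and deleting or
gluing an edge whose common neighbourhood is contractible. Graphs are considered up to
isomorphism. All members are finite. -/
inductive IsContractible : ∀ {V : Type u}, SimpleGraph V → Prop
  | point {V : Type u} [Unique V] (G : SimpleGraph V) : IsContractible G
  | iso {V W : Type u} {G : SimpleGraph V} {G' : SimpleGraph W} (e : G ≃g G')
      (hG : IsContractible G) : IsContractible G'
  | deleteVertex {V : Type u} (G : SimpleGraph V) (v : V) (hG : IsContractible G)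
      (hv : IsContractible (G.induce (G.neighborSet v))) :
      IsContractible (G.induce {v}ᶜ)
  | glueVertex {V : Type u} (G : SimpleGraph V) (v : V)
      (hG : IsContractible (G.induce {v}ᶜ))
      (hv : IsContractible (G.induce (G.neighborSet v))) :
      IsContractible G
  | deleteEdge {V : Type u} (G : SimpleGraph V) (v₁ v₂ : V) (hadj : G.Adj v₁ v₂)
      (hG : IsContractible G)
      (he : IsContractible (G.induce (G.commonNeighbors v₁ v₂))) :
      IsContractible (G.deleteEdges {s(v₁, v₂)})
  | glueEdge {V : Type u} (G : SimpleGraph V) (v₁ v₂ : V) (hne : v₁ ≠ v₂)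
      (hadj : ¬ G.Adj v₁ v₂) (hG : IsContractible G)
      (he : IsContractible (G.induce (G.commonNeighbors v₁ v₂))) :
      IsContractible (G ⊔ SimpleGraph.edge v₁ v₂)

/-- A graph whose vertex set is a subset of `V`. -/
abbrev GraphIn (V : Type u) : Type u := (⊤ : SimpleGraph V).Subgraph

section Graphs

variable {V : Type u}

/-- The neighbourhood `N_G(v)`, as an induced subgraph of `G`. -/
def nbhd (G : GraphIn V) (v : V) : GraphIn V := G.induce (G.neighborSet v)

/-- `v` is a contractible vertex of `G`. -/
def IsContractibleVertex (G : GraphIn V) (v : V) : Prop :=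
  v ∈ G.verts ∧ IsContractible (nbhd G v).coe

/-- `S = (v₁, …, v_k)` is a sequence of contractible vertices of `G`: `v₁` is a contractible vertex
of `G`, `v₂` is one of `G - v₁`, and so on. -/
def IsContractibleSeq (G : GraphIn V) : List V → Prop
  | [] => True
  | v :: S => IsContractibleVertex G v ∧ IsContractibleSeq (G.deleteVerts {v}) S

/-- The reduced graph `I(G; S) = G - v₁ - ⋯ - v_k`. -/
def reduce (G : GraphIn V) : List V → GraphIn V
  | [] => G
  | v :: S => reduce (G.deleteVerts {v}) S

/-- The clique complex of `G`: its simplices are the vertex sets of complete subgraphs. -/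
def cliqueComplex (G : GraphIn V) : PreAbstractSimplicialComplex V where
  faces := {s | s.Nonempty ∧ (∀ v ∈ s, v ∈ G.verts) ∧ ∀ v ∈ s, ∀ w ∈ s, v ≠ w → G.Adj v w}
  isRelLowerSet_faces := fun _ hs => ⟨hs.1, fun _ hts ht =>
    ⟨ht, fun v hv => hs.2.1 v (hts hv), fun v hv w hw => hs.2.2 v (hts hv) w (hts hw)⟩⟩

open Classical in
/-- The 1-skeleton of a simplicial complex. -/
def oneSkeleton (K : PreAbstractSimplicialComplex V) : GraphIn V where
  verts := {v | {v} ∈ K.faces}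
  Adj v w := v ≠ w ∧ {v, w} ∈ K.faces
  adj_sub h := h.1
  edge_vert h := (K.isRelLowerSet_faces h.2).2 (by simp) (by simp)
  symm := ⟨fun v w h => ⟨h.1.symm, by rw [Finset.pair_comm]; exact h.2⟩⟩

theorem cliqueComplex_mono {G H : GraphIn V} (h : G ≤ H) : cliqueComplex G ≤ cliqueComplex H :=
  fun _ hs => ⟨hs.1, fun v hv => h.1 (hs.2.1 v hv), fun v hv w hw hne =>
    h.2 (hs.2.2 v hv w hw hne)⟩

theorem oneSkeleton_mono {K L : PreAbstractSimplicialComplex V} (h : K ≤ L) :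
    oneSkeleton K ≤ oneSkeleton L :=
  ⟨fun _ hv => h hv, fun _ _ hvw => ⟨hvw.1, h hvw.2⟩⟩

end Graphs

section Homology

variable {V : Type u} (A : Type w) [AddCommGroup A]

/-- The group `C_n(K)` of oriented `n`-chains with coefficients in `A`, on a finite vertex set: a
chain gives a coefficient to every oriented simplex `[v₀ … v_n]`; the coefficient changes by the
sign of `σ` when the vertices are permuted by `σ`, and it is zero unless `v₀, …, v_n` are the
distinct vertices of a simplex of `K`. -/
def chains (K : PreAbstractSimplicialComplex V) (n : ℕ) : AddSubgroup ((Fin (n + 1) → V) → A) where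
  carrier := {c | (∀ (σ : Equiv.Perm (Fin (n + 1))) (t : Fin (n + 1) → V),
      c (t ∘ σ) = Equiv.Perm.sign σ • c t) ∧
    ∀ t : Fin (n + 1) → V, c t ≠ 0 →
      ∃ ht : Function.Injective t, Finset.univ.map ⟨t, ht⟩ ∈ K.faces}
  zero_mem' := ⟨fun _ _ => by simp, fun _ h => absurd rfl h⟩
  add_mem' := by
    rintro a b ⟨ha, ha'⟩ ⟨hb, hb'⟩
    refine ⟨fun σ t => by simp [ha, hb], fun t h => ?_⟩
    by_cases h0 : a t = 0
    · exact hb' t (by simpa [h0] using h)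
    · exact ha' t h0
  neg_mem' := by
    rintro a ⟨ha, ha'⟩
    exact ⟨fun σ t => by simp [ha], fun t h => ha' t (by simpa using h)⟩

theorem chains_mono {K L : PreAbstractSimplicialComplex V} (h : K ≤ L) (n : ℕ) :
    chains A K n ≤ chains A L n :=
  fun _ hc => ⟨hc.1, fun t ht => (hc.2 t ht).imp fun _ hf => h hf⟩

/-- The join `v * b` of a vertex `v` with a chain `b`, i.e. the linear extension of
`v * [v₀ … v_{n-1}] = [v v₀ … v_{n-1}]`. -/
noncomputable def join (v : V) {n : ℕ} (b : (Fin n → V) → A) : (Fin (n + 1) → V) → A :=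
  open Classical in
  fun t => ∑ k : Fin (n + 1), if t k = v then (-1 : ℤ) ^ (k : ℕ) • b (k.removeNth t) else 0

variable [Fintype V]

/-- The boundary operator `∂[v₀ … v_n] = ∑ k, (-1)^k [v₀ … v̂_k … v_n]`. In terms of coefficients of
oriented simplices, the coefficient of `[t₀ … t_{n-1}]` in `∂c` is the sum over all vertices `v` of
the coefficient of `[v t₀ … t_{n-1}]` in `c`. -/
def boundary (n : ℕ) : ((Fin (n + 1) → V) → A) →+ ((Fin n → V) → A) where
  toFun c := fun t => ∑ v : V, c (Fin.cons v t)
  map_zero' := by ext; simp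
  map_add' a b := by ext; simp [Finset.sum_add_distrib]

/-- The group `Z_n(K)` of `n`-cycles; the boundary of a `0`-chain is zero. -/
def cycles (K : PreAbstractSimplicialComplex V) : ∀ n : ℕ, AddSubgroup ((Fin (n + 1) → V) → A)
  | 0 => chains A K 0
  | n + 1 => chains A K (n + 1) ⊓ (boundary A (n + 1)).ker

/-- The group `B_n(K)` of `n`-boundaries. -/
def boundaries (K : PreAbstractSimplicialComplex V) (n : ℕ) :
    AddSubgroup ((Fin (n + 1) → V) → A) :=
  (chains A K (n + 1)).map (boundary A (n + 1))

theorem cycles_mono {K L : PreAbstractSimplicialComplex V} (h : K ≤ L) (n : ℕ) :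
    cycles A K n ≤ cycles A L n := by
  cases n with
  | zero => exact chains_mono A h 0
  | succ n => exact inf_le_inf_right _ (chains_mono A h (n + 1))

theorem boundaries_mono {K L : PreAbstractSimplicialComplex V} (h : K ≤ L) (n : ℕ) :
    boundaries A K n ≤ boundaries A L n :=
  AddSubgroup.map_mono (chains_mono A h (n + 1))

/-- The simplicial homology group `H_n(K; A) = Z_n(K) / B_n(K)`. -/
abbrev SimplicialHomology (K : PreAbstractSimplicialComplex V) (n : ℕ) : Type (max u w) :=
  cycles A K n ⧸ (boundaries A K n).addSubgroupOf (cycles A K n)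

/-- The homomorphism `H_n(K; A) → H_n(L; A)` induced by an inclusion `K ⊆ L`. -/
def homologyMap {K L : PreAbstractSimplicialComplex V} (h : K ≤ L) (n : ℕ) :
    SimplicialHomology A K n →+ SimplicialHomology A L n :=
  QuotientAddGroup.map _ _ (AddSubgroup.inclusion (cycles_mono A h n))
    (fun _ hx => boundaries_mono A h n hx)

/-- The homology group `H_n(G; A)` of a graph: its simplices are the complete subgraphs. -/
abbrev GraphHomology (G : GraphIn V) (n : ℕ) : Type (max u w) :=
  SimplicialHomology A (cliqueComplex G) n

/-- The homomorphism `H_n(G; A) → H_n(H; A)` induced by an inclusion of graphs `G ⊆ H`. -/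
def graphHomologyMap {G H : GraphIn V} (h : G ≤ H) (n : ℕ) :
    GraphHomology A G n →+ GraphHomology A H n :=
  homologyMap A (cliqueComplex_mono h) n

/-- `f : H_n(G) → H_n(G - v)` is the homomorphism `I_*(v)` induced by the deletion of `v`, that is,
by `I_#(v) : Z_n(G) → Z_n(G - v)`, `a - ∂(v * b) ↦ a`, where `a` is an `n`-cycle of `G - v` and `b`
is an `n`-chain of `N_G(v)`. -/
def IsDeletionMap (G : GraphIn V) (v : V) (n : ℕ)
    (f : GraphHomology A G n →+ GraphHomology A (G.deleteVerts {v}) n) : Prop :=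
  ∀ (z : cycles A (cliqueComplex G) n)
    (a : cycles A (cliqueComplex (G.deleteVerts {v})) n)
    (b : chains A (cliqueComplex (nbhd G v)) n),
    (z : (Fin (n + 1) → V) → A) = a - boundary A (n + 1) (join A v (b : (Fin (n + 1) → V) → A)) →
    f (QuotientAddGroup.mk z) = QuotientAddGroup.mk a

/-- `f : H_n(G) → H_n(I(G; S))` is the composition `I_*(S) = I_*(v_k) ∘ ⋯ ∘ I_*(v₁)`. -/
def IsReductionMap (n : ℕ) : ∀ (G : GraphIn V) (S : List V)
    (_ : GraphHomology A G n →+ GraphHomology A (reduce G S) n), Prop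
  | G, [], f => f = AddMonoidHom.id (GraphHomology A G n)
  | G, v :: S, f =>
    ∃ (g : GraphHomology A G n →+ GraphHomology A (G.deleteVerts {v}) n)
      (h : GraphHomology A (G.deleteVerts {v}) n →+
        GraphHomology A (reduce (G.deleteVerts {v}) S) n),
      IsDeletionMap A G v n g ∧ IsReductionMap n (G.deleteVerts {v}) S h ∧ f = h.comp g

end Homology

section VietorisRips

variable {M : Type u} [MetricSpace M]

/-- The Vietoris–Rips complex `VR(N; ε)` of a finite point cloud `N` in a metric space. For `ε ≥ 0`
its vertex set is `N`. -/
def VR (N : Finset M) (ε : ℝ) : PreAbstractSimplicialComplex N where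
  faces := {σ | σ.Nonempty ∧ ∀ x ∈ σ, ∀ y ∈ σ, dist x y ≤ ε}
  isRelLowerSet_faces := fun _ hs => ⟨hs.1, fun _ hts ht =>
    ⟨ht, fun x hx y hy => hs.2 x (hts hx) y (hts hy)⟩⟩

theorem VR_mono (N : Finset M) : Monotone (VR N) :=
  fun _ _ h _ hσ => ⟨hσ.1, fun x hx y hy => (hσ.2 x hx y hy).trans h⟩

/-- The graph `VR(N; ε)^{(1)}`. -/
def VRGraph (N : Finset M) (ε : ℝ) : GraphIn N := oneSkeleton (VR N ε)

theorem VRGraph_mono (N : Finset M) : Monotone (VRGraph N) :=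
  fun _ _ h => oneSkeleton_mono (VR_mono N h)

end VietorisRips

/-- The persistent homology group of an inclusion `K ⊆ L`: the image of `H_p(K) → H_p(L)`. -/
def persistentHomology {V : Type u} (A : Type w) [AddCommGroup A] [Fintype V]
    {K L : PreAbstractSimplicialComplex V} (h : K ≤ L) (p : ℕ) :
    AddSubgroup (SimplicialHomology A L p) :=
  (homologyMap A h p).range

end ContractibleGraph

/-! Deleting a contractible vertex changes the clique complex only by the open star of `v`, whose
link is the clique complex of the neighbourhood. If that link is acyclic, the inclusion of `G - v`
induces isomorphisms on homology. The map sending `a - ∂(v * b)` to `a` is their inverse, since the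
two cycles differ by the boundary of a chain of `G`. Composing these inverses gives `I_*(S)`, and
conjugating the map of an inclusion of graphs by such isomorphisms leaves its image unchanged up to
isomorphism. Vietoris–Rips complexes are flag, so they are recovered from their 1-skeletons.

It remains to see that contractible graphs are acyclic (`IsContractible.acyclic`), by induction over
the four transformations. The tool is `RelAcyclic.of_link`: a pair `L ⊆ K` with the same faces away
from `v` is relatively acyclic as soon as the pair of links of `v` is. One application handles a
vertex; two applications, at the two ends, handle an edge, because the double link is the clique
complex of the common neighbourhood. Then `RelAcyclic.acyclic_iff` transfers acyclicity between the
two complexes.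

Everything is done with augmented chains: `n`-tuples are simplices of dimension `n - 1`. The family
without any face, not even `∅`, has only zero chains, so relative acyclicity over it is acyclicity
in the reduced sense. -/

namespace ContractibleGraph

universe u w

/-! ### Alternating chains: contraction by a vertex and join with it. -/

section Chains

variable {V W : Type*} (A : Type*) [AddCommGroup A]

/-- Alternating functions on `n`-tuples which are supported on the injective tuples whose vertex set
belongs to `F`. If `∅ ∈ F`, these are the chains of the augmented complex. -/
def altChains (F : Set (Set V)) (n : ℕ) : AddSubgroup ((Fin n → V) → A) where
  carrier := {c | (∀ (σ : Equiv.Perm (Fin n)) (t : Fin n → V),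
      c (t ∘ σ) = Equiv.Perm.sign σ • c t) ∧
    ∀ t : Fin n → V, c t ≠ 0 → Function.Injective t ∧ Set.range t ∈ F}
  zero_mem' := ⟨fun _ _ => by simp, fun _ h => absurd rfl h⟩
  add_mem' := by
    rintro a b ⟨ha, ha'⟩ ⟨hb, hb'⟩
    refine ⟨fun σ t => by simp [ha, hb], fun t h => ?_⟩
    by_cases h0 : a t = 0
    · exact hb' t (by simpa [h0] using h)
    · exact ha' t h0
  neg_mem' := by
    rintro a ⟨ha, ha'⟩
    exact ⟨fun σ t => by simp [ha], fun t h => ha' t (by simpa using h)⟩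

/-- The link of a vertex. -/
def link (F : Set (Set V)) (v : V) : Set (Set V) := {s | v ∉ s ∧ insert v s ∈ F}

theorem isLowerSet_link {F : Set (Set V)} (hF : IsLowerSet F) (v : V) : IsLowerSet (link F v) :=
  fun _ _ hts hs => ⟨fun h => hs.1 (hts h), hF (Set.insert_subset_insert hts) hs.2⟩

/-- The contraction of a chain by a vertex: the coefficient of `[t₀ … t_{n-1}]` is that of
`[v t₀ … t_{n-1}]` in the given chain. -/
def contract (v : V) {n : ℕ} (c : (Fin (n + 1) → V) → A) : (Fin n → V) → A :=
  fun t => c (Fin.cons v t)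

variable {A}

theorem altChains_mono {F F' : Set (Set V)} (h : F ⊆ F') (n : ℕ) :
    altChains A F n ≤ altChains A F' n :=
  fun _ hc => ⟨hc.1, fun t ht => ⟨(hc.2 t ht).1, h (hc.2 t ht).2⟩⟩

theorem cons_comp_perm {n : ℕ} (v : V) (t : Fin n → V) (σ : Equiv.Perm (Fin n)) :
    (Fin.cons v (t ∘ σ) : Fin (n + 1) → V) =
      (Fin.cons v t : Fin (n + 1) → V) ∘ Equiv.Perm.decomposeFin.symm (0, σ) := by
  ext i
  refine Fin.cases ?_ (fun j => ?_) i <;> simp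

theorem apply_cons_comp_perm {F : Set (Set V)} {n : ℕ} {c : (Fin (n + 1) → V) → A}
    (hc : c ∈ altChains A F (n + 1)) (v : V) (t : Fin n → V) (σ : Equiv.Perm (Fin n)) :
    c (Fin.cons v (t ∘ σ)) = Equiv.Perm.sign σ • c (Fin.cons v t) := by
  rw [cons_comp_perm, hc.1]
  simp

theorem contract_mem {F : Set (Set V)} {n : ℕ} {c : (Fin (n + 1) → V) → A}
    (hc : c ∈ altChains A F (n + 1)) (v : V) : contract A v c ∈ altChains A (link F v) n := by
  refine ⟨fun σ t => apply_cons_comp_perm hc v t σ, fun t ht => ?_⟩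
  obtain ⟨h1, h2⟩ := hc.2 _ ht
  rw [Fin.cons_injective_iff] at h1
  rw [Fin.range_cons] at h2
  exact ⟨h1.2, h1.1, h2⟩

/-- A tuple in which `v` occurs is a permutation of one that starts with `v`. -/
theorem exists_eq_cons_comp_perm {n : ℕ} {v : V} {t : Fin (n + 1) → V} {k : Fin (n + 1)}
    (hk : t k = v) :
    ∃ (s : Fin n → V) (τ : Equiv.Perm (Fin (n + 1))), t = (Fin.cons v s : Fin (n + 1) → V) ∘ τ := by
  refine ⟨k.removeNth t, k.cycleRange, ?_⟩
  rw [← Equiv.comp_symm_eq]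
  ext i
  refine Fin.cases ?_ (fun j => ?_) i
  · simp [hk]
  · simp [Fin.removeNth]

/-- Only the position `k` of `v` contributes to the sum; moving `v` from there to the front accounts
for the sign `(-1) ^ k`, and the rest of `τ` acts on `s`. -/
theorem join_cons_comp_perm {F : Set (Set V)} {v : V} {n : ℕ} {b : (Fin n → V) → A}
    (hb : b ∈ altChains A (link F v) n) (s : Fin n → V) (τ : Equiv.Perm (Fin (n + 1))) :
    join A v b ((Fin.cons v s : Fin (n + 1) → V) ∘ τ) = Equiv.Perm.sign τ • b s := by
  classical
  set k := τ.symm 0 with hk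
  have hτk : τ k = 0 := by simp [hk]
  -- `π` sends `0` to `k` and then to `0`, so it comes from a permutation `τ'` of the remaining
  -- positions.
  set π : Equiv.Perm (Fin (n + 1)) := k.cycleRange.symm.trans τ with hπ
  obtain ⟨⟨p, τ'⟩, hp⟩ := Equiv.Perm.decomposeFin.symm.surjective π
  have hp0 : p = 0 := by
    have h := congrArg (fun e : Equiv.Perm _ => e 0) hp
    simpa [hπ, hτk] using h
  subst hp0
  have hsign : Equiv.Perm.sign τ = (-1) ^ (k : ℕ) * Equiv.Perm.sign τ' := by
    have h := congrArg Equiv.Perm.sign hp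
    rw [hπ, Equiv.Perm.decomposeFin.symm_sign] at h
    simp only [if_true, one_mul, Equiv.Perm.sign_trans, Equiv.Perm.sign_symm,
      Fin.sign_cycleRange] at h
    rw [h, mul_comm, mul_assoc, ← mul_pow]
    simp
  have hrem : k.removeNth ((Fin.cons v s : Fin (n + 1) → V) ∘ τ) = s ∘ τ' := by
    ext j
    have h := congrArg (fun e : Equiv.Perm _ => e j.succ) hp
    simp only [hπ, Equiv.trans_apply, Fin.cycleRange_symm_succ] at h
    simp [Fin.removeNth, ← h]
  unfold join
  rw [Finset.sum_eq_single k]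
  · rw [hrem, hb.1, hsign]
    simp only [Function.comp_apply, hτk, Fin.cons_zero, if_true]
    rw [mul_smul, Units.smul_def ((-1) ^ (k : ℕ))]
    simp
  -- Omitting a position other than `k` leaves `v` in the tuple, where `b` vanishes.
  · intro j _ hj
    split_ifs with h
    · by_contra hne
      have hne' : b (j.removeNth ((Fin.cons v s : Fin (n + 1) → V) ∘ τ)) ≠ 0 := by
        intro h0
        exact hne (by rw [h0, smul_zero])
      refine (hb.2 _ hne').2.1 ?_
      obtain ⟨i, hi⟩ := Fin.exists_succAbove_eq hj.symm
      exact ⟨i, by simp [Fin.removeNth, hi, hτk]⟩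
    · rfl
  · simp

theorem contract_join {F : Set (Set V)} {v : V} {n : ℕ} {b : (Fin n → V) → A}
    (hb : b ∈ altChains A (link F v) n) : contract A v (join A v b) = b := by
  ext s
  have h := join_cons_comp_perm hb s 1
  rwa [Equiv.Perm.sign_one, one_smul] at h

theorem join_mem {F : Set (Set V)} {v : V} {n : ℕ} {b : (Fin n → V) → A}
    (hb : b ∈ altChains A (link F v) n) : join A v b ∈ altChains A F (n + 1) := by
  have hzero : ∀ t : Fin (n + 1) → V, (∀ k, t k ≠ v) → join A v b t = 0 := by
    intro t ht
    simp [join, ht]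
  refine ⟨fun σ t => ?_, fun t ht => ?_⟩
  · by_cases h : ∃ k, t k = v
    · obtain ⟨k, hk⟩ := h
      obtain ⟨s, τ, rfl⟩ := exists_eq_cons_comp_perm hk
      have h := join_cons_comp_perm hb s (σ.trans τ)
      rw [join_cons_comp_perm hb, ← mul_smul, mul_comm, ← Equiv.Perm.sign_mul,
        Function.comp_assoc]
      exact h
    · push Not at h
      rw [hzero t h, hzero (t ∘ σ) fun k => h _, smul_zero]
  · by_cases h : ∃ k, t k = v
    · obtain ⟨k, hk⟩ := h
      obtain ⟨s, τ, rfl⟩ := exists_eq_cons_comp_perm hk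
      rw [join_cons_comp_perm hb] at ht
      obtain ⟨h1, h2, h3⟩ := hb.2 s fun h0 => ht (by rw [h0, smul_zero])
      refine ⟨(Fin.cons_injective_iff.2 ⟨h2, h1⟩).comp τ.injective, ?_⟩
      rwa [τ.surjective.range_comp, Fin.range_cons]
    · push Not at h
      exact absurd (hzero t h) ht

/-- A chain of `K` is a chain of `L` if its contraction by `v` is one of the link of `v` in `L` and
`K` and `L` have the same faces without `v`. -/
theorem mem_of_contract_mem {K L : Set (Set V)} {v : V} (hKL : ∀ s ∈ K, v ∉ s → s ∈ L) {n : ℕ}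
    {c : (Fin (n + 1) → V) → A} (hc : c ∈ altChains A K (n + 1))
    (hv : contract A v c ∈ altChains A (link L v) n) : c ∈ altChains A L (n + 1) := by
  refine ⟨hc.1, fun t ht => ⟨(hc.2 t ht).1, ?_⟩⟩
  by_cases h : v ∈ Set.range t
  · obtain ⟨k, hk⟩ := h
    obtain ⟨s, τ, rfl⟩ := exists_eq_cons_comp_perm hk
    rw [hc.1] at ht
    have h2 := (hv.2 s fun h0 => ht (by rw [show c (Fin.cons v s) = 0 from h0, smul_zero])).2.2
    rwa [τ.surjective.range_comp, Fin.range_cons]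
  · exact hKL _ (hc.2 t ht).2 h

theorem apply_cons_cons_swap {F : Set (Set V)} {n : ℕ} {c : (Fin (n + 2) → V) → A}
    (hc : c ∈ altChains A F (n + 2)) (v w : V) (t : Fin n → V) :
    c (Fin.cons v (Fin.cons w t : Fin (n + 1) → V)) =
      -c (Fin.cons w (Fin.cons v t : Fin (n + 1) → V)) := by
  have h := hc.1 (Equiv.swap 0 1) (Fin.cons w (Fin.cons v t : Fin (n + 1) → V))
  rw [Equiv.Perm.sign_swap (by simp)] at h
  rw [Units.neg_smul, one_smul] at h
  rw [← h]
  congr 1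
  ext i
  refine Fin.cases ?_ (fun j => ?_) i
  · simp
  · refine Fin.cases ?_ (fun l => ?_) j
    · simp
    · rw [Function.comp_apply, Equiv.swap_apply_of_ne_of_ne]
      · simp
      · exact Fin.succ_ne_zero _
      · exact fun h => Fin.succ_ne_zero l (Fin.succ_injective _ h)

theorem mem_altChains_empty {n : ℕ} {c : (Fin n → V) → A} :
    c ∈ altChains A (∅ : Set (Set V)) n ↔ c = 0 := by
  refine ⟨fun h => ?_, fun h => h ▸ zero_mem _⟩
  ext t
  by_contra ht
  exact (h.2 t ht).2

/-! ### Relative acyclicity and excision. -/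

section Boundary

variable [Fintype V]

theorem boundary_mem {F : Set (Set V)} (hF : IsLowerSet F) {n : ℕ} {c : (Fin (n + 1) → V) → A}
    (hc : c ∈ altChains A F (n + 1)) : boundary A n c ∈ altChains A F n := by
  refine ⟨fun σ t => ?_, fun t ht => ?_⟩
  · simp only [boundary, AddMonoidHom.coe_mk, ZeroHom.coe_mk, Finset.smul_sum]
    exact Finset.sum_congr rfl fun v _ => apply_cons_comp_perm hc v t σ
  · obtain ⟨v, -, hv⟩ := Finset.exists_ne_zero_of_sum_ne_zero ht
    obtain ⟨h1, h2⟩ := hc.2 _ hv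
    rw [Fin.range_cons] at h2
    exact ⟨(Fin.cons_injective_iff.1 h1).2, hF (Set.subset_insert _ _) h2⟩

/-- Exchanging the two added vertices is a sign-reversing involution; a pair that it fixes repeats a
vertex and contributes zero. -/
theorem boundary_boundary {F : Set (Set V)} {n : ℕ} {c : (Fin (n + 2) → V) → A}
    (hc : c ∈ altChains A F (n + 2)) : boundary A n (boundary A (n + 1) c) = 0 := by
  classical
  ext t
  simp only [boundary, AddMonoidHom.coe_mk, ZeroHom.coe_mk, Pi.zero_apply]
  rw [← Finset.sum_product']
  refine Finset.sum_involution (fun p _ => p.swap) (fun p _ => ?_) (fun p _ hp h => ?_)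
    (fun p _ => by simp) (fun p _ => by simp)
  · simp [apply_cons_cons_swap hc p.1 p.2]
  · have h1 := (hc.2 _ hp).1
    have h2 : p.2 = p.1 := congrArg Prod.fst h
    rw [h2] at h1
    exact (Fin.cons_injective_iff.1 h1).1 ⟨0, by simp⟩

theorem boundary_contract {F : Set (Set V)} {n : ℕ} {c : (Fin (n + 2) → V) → A}
    (hc : c ∈ altChains A F (n + 2)) (v : V) :
    boundary A n (contract A v c) = -contract A v (boundary A (n + 1) c) := by
  ext t
  simp only [boundary, contract, AddMonoidHom.coe_mk, ZeroHom.coe_mk, Pi.neg_apply,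
    ← Finset.sum_neg_distrib]
  exact Finset.sum_congr rfl fun w _ => apply_cons_cons_swap hc v w t

variable (A) in
/-- The relative homology of the pair `L ⊆ K` vanishes. For `L = ∅` this says that `K` is acyclic,
in the sense of augmented complexes. -/
def RelAcyclic (K L : Set (Set V)) : Prop :=
  (∀ c ∈ altChains A K 0, ∃ d ∈ altChains A K 1, c - boundary A 0 d ∈ altChains A L 0) ∧
  ∀ n, ∀ c ∈ altChains A K (n + 1), boundary A n c ∈ altChains A L n →
    ∃ d ∈ altChains A K (n + 2), c - boundary A (n + 1) d ∈ altChains A L (n + 1)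

/-- Excision of the star of a vertex. -/
theorem RelAcyclic.of_link {K L : Set (Set V)} {v : V} (hK : IsLowerSet K)
    (hKL : ∀ s ∈ K, v ∉ s → s ∈ L) (h : RelAcyclic A (link K v) (link L v)) :
    RelAcyclic A K L := by
  have key : ∀ n, ∀ c ∈ altChains A K (n + 1),
      (∃ d ∈ altChains A (link K v) (n + 1),
        contract A v c - boundary A n d ∈ altChains A (link L v) n) →
      ∃ d ∈ altChains A K (n + 2), c - boundary A (n + 1) d ∈ altChains A L (n + 1) := by
    rintro n c hc ⟨d, hd, hcd⟩
    have hj := join_mem hd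
    -- Contraction anticommutes with the boundary, so contracting `c + ∂(v * d)` by `v` gives the
    -- contraction of `c` minus `∂d`.
    refine ⟨-join A v d, neg_mem hj, mem_of_contract_mem hKL
      (sub_mem hc (boundary_mem hK (neg_mem hj))) ?_⟩
    convert hcd using 1
    have h1 := boundary_contract hj v
    rw [contract_join hd] at h1
    rw [h1, map_neg, sub_neg_eq_add, sub_neg_eq_add]
    rfl
  constructor
  · intro c hc
    refine ⟨0, zero_mem _, ?_⟩
    rw [map_zero, sub_zero]
    refine ⟨hc.1, fun t ht => ⟨(hc.2 t ht).1, hKL _ (hc.2 t ht).2 ?_⟩⟩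
    rintro ⟨i, -⟩
    exact i.elim0
  · intro n c hc hbc
    refine key n c hc ?_
    cases n with
    -- The contraction of a chain on vertices lies in the augmentation degree, where no cycle
    -- condition is needed.
    | zero => exact h.1 _ (contract_mem hc v)
    | succ n =>
      refine h.2 n _ (contract_mem hc v) ?_
      rw [boundary_contract hc]
      exact neg_mem (contract_mem hbc v)

theorem relAcyclic_empty_iff {K : Set (Set V)} : RelAcyclic A K ∅ ↔
    (∀ c ∈ altChains A K 0, ∃ d ∈ altChains A K 1, boundary A 0 d = c) ∧
    ∀ n, ∀ c ∈ altChains A K (n + 1), boundary A n c = 0 →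
      ∃ d ∈ altChains A K (n + 2), boundary A (n + 1) d = c := by
  simp only [RelAcyclic, mem_altChains_empty, sub_eq_zero, eq_comm (a := boundary _ _ _)]

/-- This is the part of the long exact sequence of the pair that is needed. A chain of `K` bounding
a cycle of `L` can be corrected by a boundary to lie in `L`; conversely, a cycle of `K` is
homologous to one of `L`, which bounds there. -/
theorem RelAcyclic.acyclic_iff {K L : Set (Set V)} (hLK : L ⊆ K) (h : RelAcyclic A K L) :
    RelAcyclic A K ∅ ↔ RelAcyclic A L ∅ := by
  rw [relAcyclic_empty_iff, relAcyclic_empty_iff]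
  constructor
  · rintro ⟨h0, h1⟩
    have key : ∀ n, ∀ c ∈ altChains A L n, (∃ d ∈ altChains A K (n + 1), boundary A n d = c) →
        ∃ d ∈ altChains A L (n + 1), boundary A n d = c := by
      rintro n c hc ⟨d, hd, rfl⟩
      obtain ⟨e, he, hde⟩ := h.2 n d hd hc
      exact ⟨_, hde, by rw [map_sub, boundary_boundary he, sub_zero]⟩
    exact ⟨fun c hc => key 0 c hc (h0 c (altChains_mono hLK _ hc)),
      fun n c hc hbc => key _ c hc (h1 n c (altChains_mono hLK _ hc) hbc)⟩
  · rintro ⟨h0, h1⟩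
    constructor
    · intro c hc
      obtain ⟨d, hd, hcd⟩ := h.1 c hc
      obtain ⟨e, he, hce⟩ := h0 _ hcd
      exact ⟨e + d, add_mem (altChains_mono hLK _ he) hd, by rw [map_add, hce, sub_add_cancel]⟩
    · intro n c hc hbc
      obtain ⟨d, hd, hcd⟩ := h.2 n c hc (hbc ▸ zero_mem _)
      obtain ⟨e, he, hce⟩ := h1 n _ hcd (by rw [map_sub, hbc, boundary_boundary hd, sub_zero])
      exact ⟨e + d, add_mem (altChains_mono hLK _ he) hd, by rw [map_add, hce, sub_add_cancel]⟩

end Boundary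

/-! ### Change of the ambient vertex set. -/

section Transport

variable (f : W ↪ V) {F : Set (Set V)}

/-- The faces of `F` with all vertices in `W`. -/
def comapFaces (F : Set (Set V)) : Set (Set W) := {s | f '' s ∈ F}

variable (A) in
/-- Restriction of a chain to tuples in `W`. -/
def pullback {n : ℕ} (c : (Fin n → V) → A) : (Fin n → W) → A := fun t => c (f ∘ t)

variable (A) in
/-- Extension of a chain by zero. -/
noncomputable def pushforward {n : ℕ} (c : (Fin n → W) → A) : (Fin n → V) → A :=
  Function.extend (f ∘ ·) c 0

theorem pullback_pushforward {n : ℕ} (c : (Fin n → W) → A) :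
    pullback A f (pushforward A f c) = c := by
  ext t
  exact f.injective.comp_left.extend_apply c 0 t

theorem pullback_mem {n : ℕ} {c : (Fin n → V) → A} (hc : c ∈ altChains A F n) :
    pullback A f c ∈ altChains A (comapFaces f F) n := by
  refine ⟨fun σ t => hc.1 σ (f ∘ t), fun t ht => ?_⟩
  obtain ⟨h1, h2⟩ := hc.2 _ ht
  refine ⟨h1.of_comp, ?_⟩
  rwa [Set.range_comp] at h2

theorem pushforward_mem {n : ℕ} {c : (Fin n → W) → A} (hc : c ∈ altChains A (comapFaces f F) n) :
    pushforward A f c ∈ altChains A F n := by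
  have happly : ∀ s : Fin n → W, pushforward A f c (f ∘ s) = c s :=
    fun s => f.injective.comp_left.extend_apply c 0 s
  have hzero : ∀ t : Fin n → V, (¬ ∃ s : Fin n → W, f ∘ s = t) → pushforward A f c t = 0 :=
    fun t ht => Function.extend_apply' _ _ _ ht
  refine ⟨fun σ t => ?_, fun t ht => ?_⟩
  · by_cases h : ∃ s : Fin n → W, f ∘ s = t
    · obtain ⟨s, rfl⟩ := h
      rw [Function.comp_assoc, happly, happly, hc.1]
    · rw [hzero t h, hzero, smul_zero]
      rintro ⟨s, hs⟩
      exact h ⟨s ∘ σ.symm, by rw [← Function.comp_assoc, hs]; ext; simp⟩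
  · by_cases h : ∃ s : Fin n → W, f ∘ s = t
    · obtain ⟨s, rfl⟩ := h
      rw [happly] at ht
      refine ⟨f.injective.comp (hc.2 s ht).1, ?_⟩
      rw [Set.range_comp]
      exact (hc.2 s ht).2
    · exact absurd (hzero t h) ht

variable (hF : ∀ s ∈ F, s ⊆ Set.range f)
include hF

theorem pullback_injOn {n : ℕ} {c c' : (Fin n → V) → A} (hc : c ∈ altChains A F n)
    (hc' : c' ∈ altChains A F n) (h : pullback A f c = pullback A f c') : c = c' := by
  rw [← sub_eq_zero]
  ext t
  by_contra ht
  choose s hs using fun i => hF _ ((sub_mem hc hc').2 t ht).2 ⟨i, rfl⟩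
  obtain rfl : f ∘ s = t := funext hs
  exact ht (sub_eq_zero.2 (congrFun h s))

theorem pullback_boundary [Fintype V] [Fintype W] {n : ℕ} {c : (Fin (n + 1) → V) → A}
    (hc : c ∈ altChains A F (n + 1)) :
    pullback A f (boundary A n c) = boundary A n (pullback A f c) := by
  ext t
  simp only [pullback, boundary, AddMonoidHom.coe_mk, ZeroHom.coe_mk]
  refine (Fintype.sum_of_injective f f.injective _ _ (fun v hv => ?_) fun w => ?_).symm
  · by_contra hne
    refine hv (hF _ (hc.2 _ hne).2 ?_)
    exact ⟨0, by simp⟩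
  · congr 1
    ext i
    refine Fin.cases ?_ (fun j => ?_) i <;> simp

/-- Acyclicity does not depend on the ambient vertex set. -/
theorem relAcyclic_comapFaces_iff [Fintype V] [Fintype W] (hlow : IsLowerSet F) :
    RelAcyclic A (comapFaces f F) ∅ ↔ RelAcyclic A F ∅ := by
  rw [relAcyclic_empty_iff, relAcyclic_empty_iff]
  have up : ∀ n, ∀ c ∈ altChains A F n,
      (∃ d ∈ altChains A (comapFaces f F) (n + 1), boundary A n d = pullback A f c) →
      ∃ d ∈ altChains A F (n + 1), boundary A n d = c := by
    rintro n c hc ⟨d, hd, hdc⟩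
    have hp := pushforward_mem f hd
    refine ⟨_, hp, pullback_injOn f hF (boundary_mem hlow hp) hc ?_⟩
    rw [pullback_boundary f hF hp, pullback_pushforward, hdc]
  have down : ∀ n, ∀ c ∈ altChains A (comapFaces f F) n,
      (∃ d ∈ altChains A F (n + 1), boundary A n d = pushforward A f c) →
      ∃ d ∈ altChains A (comapFaces f F) (n + 1), boundary A n d = c := by
    rintro n c hc ⟨d, hd, hdc⟩
    refine ⟨_, pullback_mem f hd, ?_⟩
    rw [← pullback_boundary f hF hd, hdc, pullback_pushforward]
  constructor
  · rintro ⟨h0, h1⟩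
    refine ⟨fun c hc => up 0 c hc (h0 _ (pullback_mem f hc)),
      fun n c hc hbc => up _ c hc (h1 n _ (pullback_mem f hc) ?_)⟩
    rw [← pullback_boundary f hF hc, hbc]
    rfl
  · rintro ⟨h0, h1⟩
    refine ⟨fun c hc => down 0 c hc (h0 _ (pushforward_mem f hc)),
      fun n c hc hbc => down _ c hc (h1 n _ (pushforward_mem f hc) ?_)⟩
    have hp := pushforward_mem f hc
    refine pullback_injOn f hF (boundary_mem hlow hp) (zero_mem _) ?_
    rw [pullback_boundary f hF hp, pullback_pushforward, hbc]
    rfl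

end Transport

end Chains

/-! ### Acyclicity of contractible graphs. -/

section Cliques

variable {V : Type u}

/-- The vertex sets of complete subgraphs, including `∅`. -/
def cliques (G : SimpleGraph V) : Set (Set V) := {s | G.IsClique s}

theorem isLowerSet_cliques (G : SimpleGraph V) : IsLowerSet (cliques G) :=
  fun _ _ hts hs => hs.subset hts

/-- `F` is described by its members so that links, double links and restrictions to `{v}ᶜ` can all
take its place. -/
theorem relAcyclic_cliques_induce_iff (A : Type w) [AddCommGroup A] [Fintype V] (G : SimpleGraph V)
    (S : Set V) [Fintype S] {F : Set (Set V)} (hF : ∀ s, s ∈ F ↔ s ⊆ S ∧ G.IsClique s) :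
    RelAcyclic A (cliques (G.induce S)) ∅ ↔ RelAcyclic A F ∅ := by
  rw [← relAcyclic_comapFaces_iff (Function.Embedding.subtype (· ∈ S))]
  · have h : cliques (G.induce S) = comapFaces (Function.Embedding.subtype (· ∈ S)) F := by
      ext s
      simp only [cliques, comapFaces, Set.mem_ofPred_eq, hF]
      refine ⟨fun h => ⟨?_, ?_⟩, fun h => ?_⟩
      · rintro _ ⟨x, -, rfl⟩
        exact x.2
      · rintro _ ⟨x, hx, rfl⟩ _ ⟨y, hy, rfl⟩ hxy
        exact h hx hy fun h => hxy (by rw [h])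
      · intro x hx y hy hxy
        exact h.2 ⟨x, hx, rfl⟩ ⟨y, hy, rfl⟩ fun h => hxy (Subtype.ext h)
    rw [h]
  · intro s hs x hx
    exact ⟨⟨x, ((hF s).1 hs).1 hx⟩, rfl⟩
  · intro s t hts hs
    rw [hF] at hs ⊢
    exact ⟨hts.trans hs.1, hs.2.subset hts⟩

theorem mem_link_cliques_iff (G : SimpleGraph V) (v : V) (s : Set V) :
    s ∈ link (cliques G) v ↔ s ⊆ G.neighborSet v ∧ G.IsClique s := by
  simp only [link, cliques, Set.mem_ofPred_eq, SimpleGraph.isClique_insert]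
  refine ⟨fun h => ⟨fun x hx => h.2.2 x hx fun e => h.1 (e ▸ hx), h.2.1⟩, fun h => ⟨fun hv => ?_,
    h.2, fun x hx _ => h.1 hx⟩⟩
  exact G.irrefl (h.1 hv)

theorem mem_link_link_cliques_iff (G : SimpleGraph V) {v w : V} (hvw : G.Adj v w) (s : Set V) :
    s ∈ link (link (cliques G) v) w ↔ s ⊆ G.commonNeighbors v w ∧ G.IsClique s := by
  have h := mem_link_cliques_iff G v (insert w s)
  have h' := mem_link_cliques_iff G w s
  simp only [link, cliques, Set.mem_ofPred_eq] at h h' ⊢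
  rw [h, Set.insert_subset_iff, SimpleGraph.mem_neighborSet, SimpleGraph.commonNeighbors,
    Set.subset_inter_iff]
  tauto

theorem relAcyclic_cliques_compl (A : Type w) [AddCommGroup A] [Fintype V] (G : SimpleGraph V)
    (v : V) [Fintype (G.neighborSet v)]
    (h : RelAcyclic A (cliques (G.induce (G.neighborSet v))) ∅) :
    RelAcyclic A (cliques G) {s | s ⊆ {v}ᶜ ∧ G.IsClique s} := by
  refine RelAcyclic.of_link (v := v) (isLowerSet_cliques G)
    (fun s hs hv => ⟨Set.subset_compl_singleton_iff.2 hv, hs⟩) ?_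
  rw [relAcyclic_cliques_induce_iff A G _ (mem_link_cliques_iff G v)] at h
  convert h
  ext s
  simp [link]

theorem relAcyclic_cliques_iff_induce_compl (A : Type w) [AddCommGroup A] [Fintype V]
    (G : SimpleGraph V) (v : V) [Fintype (G.neighborSet v)] [Fintype ({v}ᶜ : Set V)]
    (h : RelAcyclic A (cliques (G.induce (G.neighborSet v))) ∅) :
    RelAcyclic A (cliques G) ∅ ↔ RelAcyclic A (cliques (G.induce {v}ᶜ)) ∅ := by
  rw [(relAcyclic_cliques_compl A G v h).acyclic_iff fun s hs => hs.2]
  exact (relAcyclic_cliques_induce_iff A G _ fun s => Iff.rfl).symm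

/-- The cliques of `G` lost in `H` are those containing both `v` and `w`. Excision at `v` and then
at `w` reduces the pair to its double links, and that of `H` has no faces. -/
theorem relAcyclic_cliques_iff_of_edge (A : Type w) [AddCommGroup A] [Fintype V]
    (G H : SimpleGraph V) {v w : V} (hG : G.Adj v w) (hH : ¬ H.Adj v w)
    (hGH : ∀ a b, H.Adj a b ↔ G.Adj a b ∧ s(a, b) ≠ s(v, w))
    (h : RelAcyclic A (link (link (cliques G) v) w) ∅) :
    RelAcyclic A (cliques G) ∅ ↔ RelAcyclic A (cliques H) ∅ := by
  have hclique : ∀ s, G.IsClique s → ¬ (v ∈ s ∧ w ∈ s) → H.IsClique s := by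
    intro s hs hvw a ha b hb hab
    refine (hGH a b).2 ⟨hs ha hb hab, fun he => hvw ?_⟩
    rcases Sym2.eq_iff.1 he with ⟨rfl, rfl⟩ | ⟨rfl, rfl⟩
    exacts [⟨ha, hb⟩, ⟨hb, ha⟩]
  refine RelAcyclic.acyclic_iff (fun s hs => hs.mono fun a b hab => ((hGH a b).1 hab).1) ?_
  refine RelAcyclic.of_link (v := v) (isLowerSet_cliques G) (fun s hs hv => hclique s hs (hv ·.1)) ?_
  refine RelAcyclic.of_link (v := w) (isLowerSet_link (isLowerSet_cliques G) v)
    (fun s hs hw => ⟨hs.1, hclique _ hs.2 ?_⟩) ?_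
  · rintro ⟨-, hw' | hw'⟩
    exacts [hG.ne hw'.symm, hw hw']
  · convert h
    ext s
    simp only [link, cliques, Set.mem_ofPred_eq, Set.mem_empty_iff_false, iff_false]
    rintro ⟨-, -, hs⟩
    exact hH (hs (by simp) (by simp) hG.ne)

/-- There is just one tuple of each length, so the sum defining the boundary has a single term and
the boundary loses no information. -/
theorem relAcyclic_cliques_of_unique (A : Type w) [AddCommGroup A] [Unique V] [Fintype V]
    (G : SimpleGraph V) : RelAcyclic A (cliques G) ∅ := by
  have hcons : ∀ n (t : Fin (n + 1) → V), t = Fin.cons default (Fin.tail t) :=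
    fun n t => Subsingleton.elim _ _
  rw [relAcyclic_empty_iff]
  refine ⟨fun c _ => ⟨fun t => c (Fin.tail t), ⟨fun σ t => ?_, fun t _ => ⟨?_, ?_⟩⟩, ?_⟩,
    fun n c hc hbc => ⟨0, zero_mem _, ?_⟩⟩
  · rw [Subsingleton.elim σ 1]
    simp
  · exact Function.injective_of_subsingleton t
  · exact Set.Subsingleton.pairwise Set.subsingleton_of_subsingleton _
  · ext t
    simp only [boundary, AddMonoidHom.coe_mk, ZeroHom.coe_mk, Fin.tail_cons]
    rw [Fintype.sum_unique]
  · rw [map_zero]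
    ext t
    have h := congrFun hbc (Fin.tail t)
    simp only [boundary, AddMonoidHom.coe_mk, ZeroHom.coe_mk] at h
    rw [Fintype.sum_unique] at h
    rw [hcons n t]
    exact h.symm

/-- Contractible graphs are finite and acyclic. -/
theorem IsContractible.acyclic (A : Type w) [AddCommGroup A] {G : SimpleGraph V}
    (hG : IsContractible G) :
    Finite V ∧ ∀ [Fintype V], RelAcyclic A (cliques G) ∅ := by
  classical
  induction hG with
  | point G => exact ⟨inferInstance, relAcyclic_cliques_of_unique A G⟩
  | @iso V W G G' e _ ih =>
    have := ih.1
    refine ⟨Finite.of_equiv V e.toEquiv, ?_⟩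
    intro _
    have := Fintype.ofFinite V
    have h := ih.2
    have heq : cliques G = comapFaces e.toEquiv.toEmbedding (cliques G') := by
      ext s
      refine ⟨?_, fun hs x hx y hy hxy => ?_⟩
      · rintro hs _ ⟨x, hx, rfl⟩ _ ⟨y, hy, rfl⟩ hxy
        exact e.map_rel_iff.2 (hs hx hy fun h => hxy (by rw [h]))
      · exact e.map_rel_iff.1 (hs ⟨x, hx, rfl⟩ ⟨y, hy, rfl⟩ fun h => hxy (e.injective h))
    rw [heq, relAcyclic_comapFaces_iff] at h
    · exact h
    · intro s _ x _
      exact e.surjective x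
    · exact isLowerSet_cliques G'
  | @deleteVertex V G v _ _ ihG ihv =>
    have := ihG.1
    refine ⟨inferInstance, ?_⟩
    intro _
    have := Fintype.ofFinite V
    exact (relAcyclic_cliques_iff_induce_compl A G v ihv.2).1 ihG.2
  | @glueVertex V G v _ _ ihG ihv =>
    have : Finite V := by
      have := ihG.1
      have h := (Set.toFinite ({v}ᶜ : Set V)).union (Set.finite_singleton v)
      rw [Set.compl_union_self] at h
      exact Set.finite_univ_iff.1 h
    refine ⟨this, ?_⟩
    intro _
    exact (relAcyclic_cliques_iff_induce_compl A G v ihv.2).2 ihG.2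
  | deleteEdge G v₁ v₂ hadj _ _ ihG ihe =>
    have := ihG.1
    refine ⟨this, ?_⟩
    intro _
    refine (relAcyclic_cliques_iff_of_edge A G _ hadj (by simp) (by simp) ?_).1 ihG.2
    exact (relAcyclic_cliques_induce_iff A G _ (mem_link_link_cliques_iff G hadj)).1 ihe.2
  | glueEdge G v₁ v₂ hne hadj _ _ ihG ihe =>
    have := ihG.1
    refine ⟨this, ?_⟩
    intro _
    have hadj' : (G ⊔ SimpleGraph.edge v₁ v₂).Adj v₁ v₂ := by simp [SimpleGraph.edge_adj, hne]
    have hG : ∀ a b, G.Adj a b ↔ (G ⊔ SimpleGraph.edge v₁ v₂).Adj a b ∧ s(a, b) ≠ s(v₁, v₂) := by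
      intro a b
      simp only [SimpleGraph.sup_adj, SimpleGraph.edge_adj, ne_eq, Sym2.eq_iff]
      have := fun h : G.Adj v₂ v₁ => hadj h.symm
      grind
    -- The new edge joins `v₁` to `v₂`, neither of which is a common neighbour, so it affects
    -- neither the common neighbourhood nor the cliques inside it.
    have hcn : (G ⊔ SimpleGraph.edge v₁ v₂).commonNeighbors v₁ v₂ = G.commonNeighbors v₁ v₂ := by
      ext x
      simp only [SimpleGraph.mem_commonNeighbors, hG, ne_eq, Sym2.eq_iff]
      have := (G ⊔ SimpleGraph.edge v₁ v₂).irrefl (v := v₁)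
      have := (G ⊔ SimpleGraph.edge v₁ v₂).irrefl (v := v₂)
      grind
    refine (relAcyclic_cliques_iff_of_edge A _ G hadj' hadj hG ?_).2 ihG.2
    refine (relAcyclic_cliques_induce_iff A G _ fun s => ?_).1 ihe.2
    rw [mem_link_link_cliques_iff _ hadj', hcn]
    refine and_congr_right fun hs => ⟨fun h a ha b hb hab => (hG a b).2 ⟨h ha hb hab, fun he => ?_⟩,
      fun h => h.mono le_sup_left⟩
    rcases Sym2.eq_iff.1 he with ⟨rfl, rfl⟩ | ⟨rfl, rfl⟩
    exacts [G.irrefl (hs ha).1, G.irrefl (hs hb).1]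

end Cliques

/-! ### Homology of the clique complex and the deletion maps. -/

section Deletion

variable {V : Type u} (A : Type w) [AddCommGroup A]

/-- The faces of a simplicial complex as sets, together with `∅`. -/
def augFaces (K : PreAbstractSimplicialComplex V) : Set (Set V) :=
  {s | s = ∅ ∨ ∃ f ∈ K.faces, (f : Set V) = s}

theorem chains_eq_altChains (K : PreAbstractSimplicialComplex V) (n : ℕ) :
    chains A K n = altChains A (augFaces K) (n + 1) := by
  ext c
  refine and_congr_right fun _ => forall_congr' fun t => imp_congr_right fun _ => ?_
  constructor
  · rintro ⟨ht, hf⟩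
    exact ⟨ht, Or.inr ⟨_, hf, by simp⟩⟩
  · rintro ⟨ht, h | ⟨f, hf, hft⟩⟩
    · exact absurd h (Set.range_nonempty t).ne_empty
    · refine ⟨ht, ?_⟩
      convert hf
      apply Finset.coe_injective
      rw [hft]
      simp

variable [Fintype V]

/-- A bounding chain in `K`, or a cycle of `K`, can be moved into `L` by subtracting a boundary; the
former gives injectivity, the latter surjectivity. -/
theorem homologyMap_bijective {K L : PreAbstractSimplicialComplex V} (h : L ≤ K)
    (hrel : RelAcyclic A (augFaces K) (augFaces L)) (n : ℕ) :
    Function.Bijective (homologyMap A h n) := by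
  constructor
  · rw [injective_iff_map_eq_zero]
    intro x hx
    obtain ⟨⟨a, ha⟩, rfl⟩ := QuotientAddGroup.mk_surjective x
    have hx' := (QuotientAddGroup.eq_zero_iff _).1 hx
    obtain ⟨d, hd, hda⟩ := hx'
    replace hda : boundary A (n + 1) d = a := hda
    have haL : a ∈ altChains A (augFaces L) (n + 1) := by
      rw [← chains_eq_altChains]
      cases n with
      | zero => exact ha
      | succ n => exact ha.1
    rw [SetLike.mem_coe, chains_eq_altChains] at hd
    obtain ⟨e, he, hde⟩ := hrel.2 (n + 1) d hd (hda ▸ haL)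
    refine (QuotientAddGroup.eq_zero_iff _).2 ⟨d - boundary A (n + 2) e, ?_, ?_⟩
    · rw [SetLike.mem_coe, chains_eq_altChains]
      exact hde
    · rw [map_sub, boundary_boundary he, sub_zero]
      exact hda
  · intro y
    obtain ⟨⟨z, hz⟩, rfl⟩ := QuotientAddGroup.mk_surjective y
    have key : ∃ d ∈ chains A K (n + 1), z - boundary A (n + 1) d ∈ cycles A L n := by
      cases n with
      | zero =>
        have hz' : z ∈ altChains A (augFaces K) 1 := chains_eq_altChains A K 0 ▸ hz
        -- The augmentation of a `0`-chain need not vanish, but it is a chain of `L` because `∅` is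
        -- a face of `augFaces L`. Hence unreduced homology is covered too.
        obtain ⟨d, hd, hzd⟩ := hrel.2 0 z hz'
          ⟨fun σ t => by simp [Subsingleton.elim σ 1],
            fun t _ => ⟨Function.injective_of_subsingleton t, Or.inl (Set.range_eq_empty t)⟩⟩
        rw [← chains_eq_altChains] at hd hzd
        exact ⟨d, hd, hzd⟩
      | succ n =>
        have hz' : z ∈ altChains A (augFaces K) (n + 2) := chains_eq_altChains A K (n + 1) ▸ hz.1
        have hbz : boundary A (n + 1) z = 0 := hz.2
        obtain ⟨d, hd, hzd⟩ := hrel.2 (n + 1) z hz' (hbz ▸ zero_mem _)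
        refine ⟨d, chains_eq_altChains A K (n + 2) ▸ hd, chains_eq_altChains A L (n + 1) ▸ hzd, ?_⟩
        change boundary A (n + 1) _ = 0
        rw [map_sub, hbz, boundary_boundary hd, sub_zero]
    obtain ⟨d, hd, hzd⟩ := key
    refine ⟨QuotientAddGroup.mk ⟨_, hzd⟩, ?_⟩
    refine QuotientAddGroup.eq.2 ⟨d, hd, ?_⟩
    change boundary A (n + 1) d = -(z - boundary A (n + 1) d) + z
    abel

theorem mem_augFaces_cliqueComplex_iff (G : GraphIn V) (s : Set V) :
    s ∈ augFaces (cliqueComplex G) ↔ s ⊆ G.verts ∧ G.spanningCoe.IsClique s := by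
  classical
  constructor
  · rintro (rfl | ⟨f, hf, rfl⟩)
    · simp
    · exact ⟨fun v hv => hf.2.1 v hv, fun v hv w hw hvw => hf.2.2 v hv w hw hvw⟩
  · rintro ⟨h1, h2⟩
    rcases s.eq_empty_or_nonempty with rfl | hs
    · exact Or.inl rfl
    · refine Or.inr ⟨s.toFinset, ⟨?_, ?_, ?_⟩, by simp⟩
      · simpa using hs
      · intro v hv
        exact h1 (by simpa using hv)
      · intro v hv w hw hvw
        exact h2 (by simpa using hv) (by simpa using hw) hvw

theorem isLowerSet_augFaces_cliqueComplex (G : GraphIn V) :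
    IsLowerSet (augFaces (cliqueComplex G)) := by
  intro s t hts hs
  rw [mem_augFaces_cliqueComplex_iff] at hs ⊢
  exact ⟨hts.trans hs.1, hs.2.subset hts⟩

theorem mem_link_augFaces_iff (G : GraphIn V) {v : V} (hv : v ∈ G.verts) (s : Set V) :
    s ∈ link (augFaces (cliqueComplex G)) v ↔
      s ⊆ G.neighborSet v ∧ G.spanningCoe.IsClique s := by
  have h := mem_link_cliques_iff G.spanningCoe v s
  simp only [link, cliques, Set.mem_ofPred_eq] at h ⊢
  rw [mem_augFaces_cliqueComplex_iff, Set.insert_subset_iff]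
  change _ ↔ s ⊆ G.spanningCoe.neighborSet v ∧ _
  rw [← h]
  refine ⟨fun h' => ⟨h'.1, h'.2.2⟩, fun h' => ⟨h'.1, ⟨hv, fun w hw => ?_⟩, h'.2⟩⟩
  have hvw : G.Adj v w := (h.1 h').1 hw
  exact G.edge_vert hvw.symm

theorem relAcyclic_augFaces_deleteVerts (G : GraphIn V) {v : V} (hv : IsContractibleVertex G v) :
    RelAcyclic A (augFaces (cliqueComplex G))
      (augFaces (cliqueComplex (G.deleteVerts {v}))) := by
  classical
  refine RelAcyclic.of_link (v := v) (isLowerSet_augFaces_cliqueComplex G) (fun s hs hvs => ?_) ?_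
  · rw [mem_augFaces_cliqueComplex_iff] at hs ⊢
    have hmem : ∀ w ∈ s, w ∈ G.verts ∧ w ∉ ({v} : Set V) :=
      fun w hw => ⟨hs.1 hw, fun h => hvs (by rwa [← Set.mem_singleton_iff.1 h])⟩
    refine ⟨hmem, fun a ha b hb hab => ?_⟩
    exact SimpleGraph.Subgraph.deleteVerts_adj.2
      ⟨(hmem a ha).1, (hmem a ha).2, (hmem b hb).1, (hmem b hb).2, hs.2 ha hb hab⟩
  · have hempty : link (augFaces (cliqueComplex (G.deleteVerts {v}))) v = ∅ := by
      ext s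
      simp only [Set.mem_empty_iff_false, iff_false]
      rintro ⟨-, hs⟩
      rw [mem_augFaces_cliqueComplex_iff] at hs
      exact (hs.1 (Set.mem_insert v s)).2 rfl
    have hcoe : (nbhd G v).coe = G.spanningCoe.induce (G.neighborSet v) := by
      ext a b
      exact ⟨fun h => h.2.2, fun h => ⟨a.2, b.2, h⟩⟩
    have h : IsContractible (G.spanningCoe.induce (G.neighborSet v)) := by
      have h := hv.2
      rw [hcoe] at h
      exact h
    rw [hempty]
    exact (relAcyclic_cliques_induce_iff A G.spanningCoe (G.neighborSet v)
      (mem_link_augFaces_iff G hv.1)).1 (h.acyclic A).2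

/-- The isomorphism `H_n(G) ≃ H_n(G - v)` inverse to the inclusion. -/
noncomputable def deletionEquiv (G : GraphIn V) {v : V} (hv : IsContractibleVertex G v) (n : ℕ) :
    GraphHomology A G n ≃+ GraphHomology A (G.deleteVerts {v}) n :=
  (AddEquiv.ofBijective (graphHomologyMap A (SimpleGraph.Subgraph.deleteVerts_le) n)
    (homologyMap_bijective A _ (relAcyclic_augFaces_deleteVerts A G hv) n)).symm

/-- It suffices that `a` and `z` are homologous in `G`. They differ by `∂(v * b)`, and `v * b` is a
chain of `G` because cliques of the neighbourhood are faces of the link of `v`. -/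
theorem isDeletionMap_deletionEquiv (G : GraphIn V) {v : V} (hv : IsContractibleVertex G v)
    (n : ℕ) : IsDeletionMap A G v n (deletionEquiv A G hv n).toAddMonoidHom := by
  rintro z a ⟨b, hb⟩ hz
  refine (AddEquiv.symm_apply_eq _).2 ?_
  refine QuotientAddGroup.eq.2 ⟨join A v b, ?_, ?_⟩
  · rw [SetLike.mem_coe, chains_eq_altChains]
    rw [chains_eq_altChains] at hb
    refine join_mem (altChains_mono (fun s hs => ?_) _ hb)
    rw [mem_augFaces_cliqueComplex_iff] at hs
    exact (mem_link_augFaces_iff G hv.1 s).2 ⟨hs.1, fun x hx y hy hxy => (hs.2 hx hy hxy).2.2⟩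
  · change boundary A (n + 1) (join A v b) = -(z : (Fin (n + 1) → V) → A) + a
    rw [hz]
    abel

theorem exists_isReductionMap (n : ℕ) (G : GraphIn V) (S : List V) (hS : IsContractibleSeq G S) :
    ∃ e : GraphHomology A G n ≃+ GraphHomology A (reduce G S) n,
      IsReductionMap A n G S e.toAddMonoidHom := by
  induction S generalizing G with
  | nil => exact ⟨AddEquiv.refl _, rfl⟩
  | cons v S ih =>
    obtain ⟨e, he⟩ := ih _ hS.2
    exact ⟨(deletionEquiv A G hS.1 n).trans e, _, _, isDeletionMap_deletionEquiv A G hS.1 n, he,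
      rfl⟩

end Deletion

/-! ### Vietoris–Rips complexes and persistent homology. -/

theorem cliqueComplex_VRGraph {M : Type u} [MetricSpace M] (N : Finset M) (ε : ℝ) :
    cliqueComplex (VRGraph N ε) = VR N ε := by
  classical
  ext s
  constructor
  · rintro ⟨hs, h1, h2⟩
    refine ⟨hs, fun x hx y hy => ?_⟩
    by_cases hxy : x = y
    · subst hxy
      exact (h1 x hx).2 x (by simp) x (by simp)
    · exact (h2 x hx y hy hxy).2.2 x (by simp) y (by simp)
  · rintro ⟨hs, h⟩
    refine ⟨hs, fun v hv => ⟨by simp, ?_⟩, fun v hv w hw hvw => ⟨hvw, by simp, ?_⟩⟩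
    · simpa using h v hv v hv
    · intro x hx y hy
      refine h x ?_ y ?_ <;> aesop

theorem nonempty_range_homologyMap_equiv {V : Type u} (A : Type w) [AddCommGroup A] [Fintype V]
    {K K' L L' : PreAbstractSimplicialComplex V} (hK : K = K') (hL : L = L') (h : K ≤ L)
    (h' : K' ≤ L') (p : ℕ) :
    Nonempty ((homologyMap A h p).range ≃+ (homologyMap A h' p).range) := by
  subst hK hL
  exact ⟨AddEquiv.refl _⟩

/-- Conjugation by isomorphisms does not change the image of a homomorphism. -/
theorem nonempty_range_equiv {B C B' C' : Type*} [AddCommGroup B] [AddCommGroup C]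
    [AddCommGroup B'] [AddCommGroup C'] (e : B ≃+ B') (e' : C ≃+ C') (f : B →+ C)
    (g : B' →+ C') (hfg : ∀ x, g (e x) = e' (f x)) : Nonempty (f.range ≃+ g.range) := by
  have h : g.range = f.range.map e'.toAddMonoidHom := by
    ext y
    constructor
    · rintro ⟨x, rfl⟩
      exact ⟨_, ⟨e.symm x, rfl⟩, by simpa using (hfg (e.symm x)).symm⟩
    · rintro ⟨_, ⟨x, rfl⟩, rfl⟩
      exact ⟨e x, hfg x⟩
  rw [h]
  exact ⟨e'.addSubgroupMap f.range⟩

end ContractibleGraph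

open ContractibleGraph in
theorem corollary1 {M : Type*} [MetricSpace M] (N : Finset M) (A : Type*) [AddCommGroup A]
    (m : ℕ) (ε : Fin (m + 1) → ℝ) (hε : StrictMono ε)
    (hrange : Set.range ε = {r | ∃ x ∈ N, ∃ y ∈ N, dist x y = r})
    (S : Fin (m + 1) → List N)
    (hS : ∀ i, IsContractibleSeq (VRGraph N (ε i)) (S i)) (p : ℕ) :
    ∃ I : ∀ i, GraphHomology A (VRGraph N (ε i)) p ≃+
        GraphHomology A (reduce (VRGraph N (ε i)) (S i)) p,
      (∀ i, IsReductionMap A p (VRGraph N (ε i)) (S i) (I i).toAddMonoidHom) ∧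
      ∀ (i j : Fin (m + 1)) (hij : i ≤ j),
        ∃ ι : GraphHomology A (reduce (VRGraph N (ε i)) (S i)) p →+
            GraphHomology A (reduce (VRGraph N (ε j)) (S j)) p,
          (∀ x, ι (I i x) =
            I j (graphHomologyMap A (VRGraph_mono N (hε.monotone hij)) p x)) ∧
          Nonempty (persistentHomology A (VR_mono N (hε.monotone hij)) p ≃+ ι.range) := by
  choose I hI using fun i => exists_isReductionMap A p (VRGraph N (ε i)) (S i) (hS i)
  refine ⟨I, hI, fun i j hij => ?_⟩
  have hle := VRGraph_mono N (hε.monotone hij)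
  -- The required commutation forces this choice, as `I i` is invertible.
  set ι := (I j).toAddMonoidHom.comp
    ((graphHomologyMap A hle p).comp (I i).symm.toAddMonoidHom) with hι
  have hcomm : ∀ x, ι (I i x) = I j (graphHomologyMap A hle p x) := by
    intro x
    simp [hι]
  refine ⟨ι, hcomm, ?_⟩
  obtain ⟨e₁⟩ := nonempty_range_homologyMap_equiv A (cliqueComplex_VRGraph N (ε i)).symm
    (cliqueComplex_VRGraph N (ε j)).symm (VR_mono N (hε.monotone hij)) (cliqueComplex_mono hle) p
  obtain ⟨e₂⟩ := nonempty_range_equiv (I i) (I j) (graphHomologyMap A hle p) ι hcomm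
  exact ⟨e₁.trans e₂⟩
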